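/- A pre-crossed module $(X,G,\pi)$ consists of groups $X$ and $G$, a right action $(x,g)\mapsto x^g$ of $G$ on $X$ by automorphisms, and a homomorphism $\pi\colon X\to G$ with $\pi(x^g)=g^{-1}\pi(x)g$. A morphism $(X,G,\pi)\to(X',G',\pi')$ is a pair of homomorphisms $X\to X'$, $G\to G'$ compatible with the actions and with $\pi,\pi'$. To $(X,G,\pi)$ one associates the simplicial group truncated to order one $X\rtimes G\rightrightarrows G$ with $d_0(x,g)=g$, $d_1(x,g)=\pi(x)g$, $s_0(g)=(1,g)$. Let $E_*=E_*(X,G,\pi)$ be its $1$-skeleton and $M_*=M_*(X,G,\pi)$ its $1$-coskeleton, i.e. its images under the left and the right adjoint of the truncation functor from simplicial groups to simplicial groups truncated to order one. The group $G=E_0=M_0$ acts freely on the right on $E_n$ and $M_n$, by multiplication by the totally degenerate simplices $s_0^nG$. Fix a commutative ring $k$ (for example $k=\mathbb Z$) and put $PH_m(X,G,\pi)=H_m(E_*/G;k)$. **Proposition.** For every $m\ge 0$ there are natural transformations $$\theta_m\colon PH_m(X,G,\pi)\to H_m(G;k),\qquad \kappa_m\colon H_m(M_*/G;k)\to H_m(G;k)$$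 of functors on the category of pre-crossed modules, where $H_m(G;k)$ is the ordinary group homology with trivial coefficients, such that: 1. $\theta_m$ is the composite of the map $H_m(E_*/G;k)\to H_m(M_*/G;k)$ induced by the canonical map $E_*\to M_*$ with $\kappa_m$; 2. $\kappa_m$ is the map classifying the free $G$-action on $M_*$: it is induced by the chain map to the complex of inhomogeneous (bar) chains of $G$ that sends the class of an $n$-simplex of $M_*$ with vertices $v_0,\dots,v_n\in G$ to $[v_0v_1^{-1}\mid v_1v_2^{-1}\mid\dots\mid v_{n-1}v_n^{-1}]$; 3. if $\pi$ is surjective, then the simplicial set underlying $M_*$ is contractible (there is a simplicial homotopy from its identity map to the constant map at the vertex $1$), and $\kappa_m$ is an isomorphism $H_m(M_*/G;k)\cong H_m(G;k)$ for all $m$. -/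

import Mathlib

open CategoryTheory Limits Opposite

universe u

/-- A pre-crossed module: groups `X` and `G`, a right action `(x, g) ↦ x ^ g` of `G` on `X` by
automorphisms, and a homomorphism `π : X → G` which is equivariant for the right conjugation
action of `G` on itself: `π (x ^ g) = g⁻¹ * π x * g`. -/
structure PreCrossedModule where
  X : Type u
  G : Type u
  [groupX : Group X]
  [groupG : Group G]
  /-- The right action of `G` on `X` by automorphisms, `x ^ g = act (op g) x`. -/
  act : Gᵐᵒᵖ →* MulAut X
  π : X →* G
  π_act : ∀ (x : X) (g : G), π (act (MulOpposite.op g) x) = g⁻¹ * π x * g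

namespace PreCrossedModule

attribute [instance] groupX groupG

/-- A morphism of pre-crossed modules: a pair of homomorphisms which commute with the structure
maps and with the actions. -/
@[ext]
structure Hom (P Q : PreCrossedModule.{u}) where
  onX : P.X →* Q.X
  onG : P.G →* Q.G
  comm : ∀ x : P.X, Q.π (onX x) = onG (P.π x)
  equivariant : ∀ (x : P.X) (g : P.G),
    onX (P.act (MulOpposite.op g) x) = Q.act (MulOpposite.op (onG g)) (onX x)

instance : Category PreCrossedModule.{u} where
  Hom P Q := Hom P Q
  id P := ⟨MonoidHom.id _, MonoidHom.id _, fun _ => rfl, fun _ _ => rfl⟩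
  comp f g := ⟨g.onX.comp f.onX, g.onG.comp f.onG,
    fun x => by simp [g.comm, f.comm], fun x a => by simp [g.equivariant, f.equivariant]⟩

/-- The functor sending `π : X → G` to the group `G`. -/
def toGroup : PreCrossedModule.{u} ⥤ GrpCat.{u} where
  obj P := GrpCat.of P.G
  map f := GrpCat.ofHom f.onG

/-- The left action of `G` on `X` that corresponds to the given right action:
`g` sends `x` to `x ^ (g⁻¹)`. -/
def leftAct (P : PreCrossedModule.{u}) : P.G →* MulAut P.X :=
  P.act.comp (MulEquiv.inv' P.G).toMonoidHom

theorem leftAct_apply (P : PreCrossedModule.{u}) (g : P.G) (x : P.X) :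
    P.leftAct g x = P.act (MulOpposite.op g⁻¹) x := rfl

/-- The semidirect product `X ⋊ G`, in which `g * (x ^ g) = x * g`. -/
abbrev Semi (P : PreCrossedModule.{u}) : Type u := P.X ⋊[P.leftAct] P.G

/-- The face map `d₀ (x, g) = g`. -/
def d₀ (P : PreCrossedModule.{u}) : P.Semi →* P.G := SemidirectProduct.rightHom

/-- The face map `d₁ (x, g) = π x * g`. -/
def d₁ (P : PreCrossedModule.{u}) : P.Semi →* P.G where
  toFun a := P.π a.left * a.right
  map_one' := by simp
  map_mul' a b := by
    rw [SemidirectProduct.mul_left, SemidirectProduct.mul_right, map_mul, leftAct_apply, P.π_act]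
    group

/-- The degeneracy `s₀ g = (1, g)`. -/
def s₀ (P : PreCrossedModule.{u}) : P.G →* P.Semi := SemidirectProduct.inr

theorem d₀_s₀ (P : PreCrossedModule.{u}) (g : P.G) : P.d₀ (P.s₀ g) = g := rfl

theorem d₁_s₀ (P : PreCrossedModule.{u}) (g : P.G) : P.d₁ (P.s₀ g) = g := by
  simp [d₁, s₀]

/-- The groups of the simplicial group truncated to order one `X ⋊ G ⇉ G`
(only the degrees `0` and `1` are used). -/
def level (P : PreCrossedModule.{u}) : ℕ → GrpCat.{u}
  | 0 => GrpCat.of P.G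
  | _ + 1 => GrpCat.of P.Semi

/-- The operator `X ⋊ G → G` that takes the `i`-th vertex of a `1`-simplex. The vertex `0` is the
face `d₁` and the vertex `1` is the face `d₀`. -/
def vertexMap (P : PreCrossedModule.{u}) {b : ℕ} (i : Fin (b + 1)) : P.Semi →* P.G :=
  if i = 0 then P.d₁ else P.d₀

/-- The operator `X ⋊ G → X ⋊ G` given by the monotone map `[1] → [1]` with values `i`, `j`. -/
def edgeMap (P : PreCrossedModule.{u}) {b : ℕ} (i j : Fin (b + 1)) : P.Semi →* P.Semi :=
  if i = j then P.s₀.comp (P.vertexMap i) else MonoidHom.id _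

theorem vertexMap_comp_s₀ (P : PreCrossedModule.{u}) {b : ℕ} (i : Fin (b + 1)) :
    (P.vertexMap i).comp P.s₀ = MonoidHom.id _ := by
  unfold vertexMap
  split_ifs
  · exact MonoidHom.ext P.d₁_s₀
  · exact MonoidHom.ext P.d₀_s₀

theorem edgeMap_comp_s₀ (P : PreCrossedModule.{u}) {b : ℕ} (i j : Fin (b + 1)) :
    (P.edgeMap i j).comp P.s₀ = P.s₀ := by
  unfold edgeMap
  split_ifs
  · rw [MonoidHom.comp_assoc, vertexMap_comp_s₀, MonoidHom.comp_id]
  · rfl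

theorem edgeMap_self (P : PreCrossedModule.{u}) {b : ℕ} (i : Fin (b + 1)) :
    P.edgeMap i i = P.s₀.comp (P.vertexMap i) := if_pos rfl

theorem vertexMap_comp_edgeMap (P : PreCrossedModule.{u}) (i j k : Fin 2) (hij : i ≤ j) :
    (P.vertexMap k).comp (P.edgeMap i j) = P.vertexMap (if k = 0 then i else j) := by
  unfold edgeMap
  split_ifs with h₁ h₂ h₂
  · rw [← MonoidHom.comp_assoc, vertexMap_comp_s₀, MonoidHom.id_comp]
  · rw [← MonoidHom.comp_assoc, vertexMap_comp_s₀, MonoidHom.id_comp, h₁]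
  · rw [MonoidHom.comp_id, show k = i by omega]
  · rw [MonoidHom.comp_id, show k = j by omega]

/-- The operators of the simplicial group truncated to order one `X ⋊ G ⇉ G`. -/
def levelMap (P : PreCrossedModule.{u}) :
    ∀ {a b : ℕ}, (Fin (a + 1) →o Fin (b + 1)) → (P.level b ⟶ P.level a)
  | 0, 0, _ => 𝟙 _
  | 0, _ + 1, f => GrpCat.ofHom (P.vertexMap (f 0))
  | _ + 1, 0, _ => GrpCat.ofHom P.s₀
  | _ + 1, _ + 1, f => GrpCat.ofHom (P.edgeMap (f 0) (f 1))

theorem levelMap_id (P : PreCrossedModule.{u}) {a : ℕ} (ha : a ≤ 1) :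
    P.levelMap (OrderHom.id : Fin (a + 1) →o Fin (a + 1)) = 𝟙 _ := by
  interval_cases a
  · rfl
  · exact congrArg GrpCat.ofHom (if_neg (by decide))

theorem levelMap_comp (P : PreCrossedModule.{u}) {a b c : ℕ} (ha : a ≤ 1) (hb : b ≤ 1)
    (hc : c ≤ 1) (f : Fin (a + 1) →o Fin (b + 1)) (g : Fin (b + 1) →o Fin (c + 1)) :
    P.levelMap (g.comp f) = P.levelMap g ≫ P.levelMap f := by
  have h2 : ∀ (k : Fin 2) (p : Fin 2 → Fin 2), p k = if k = 0 then p 0 else p 1 := by decide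
  have h1 : ∀ i : Fin 1, i = 0 := by decide
  interval_cases a <;> interval_cases b <;> interval_cases c
  · rfl
  · refine congrArg GrpCat.ofHom (congrArg P.vertexMap (?_ : g (f 0) = g 0))
    rw [h1 (f 0)]
  · exact congrArg GrpCat.ofHom (P.vertexMap_comp_s₀ _).symm
  · refine congrArg GrpCat.ofHom (?_ : P.vertexMap (g (f 0)) =
      (P.vertexMap (f 0)).comp (P.edgeMap (g 0) (g 1)))
    rw [vertexMap_comp_edgeMap _ _ _ _ (g.monotone (by decide)), ← h2 (f 0) g]
  · rfl
  · refine congrArg GrpCat.ofHom (?_ : P.edgeMap (g (f 0)) (g (f 1)) =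
      P.s₀.comp (P.vertexMap (g 0)))
    rw [h1 (f 0), h1 (f 1), edgeMap_self]
  · exact congrArg GrpCat.ofHom (P.edgeMap_comp_s₀ _ _).symm
  · refine congrArg GrpCat.ofHom (?_ : P.edgeMap (g (f 0)) (g (f 1)) =
      (P.edgeMap (f 0) (f 1)).comp (P.edgeMap (g 0) (g 1)))
    by_cases h : f 0 = f 1
    · rw [h, edgeMap_self, edgeMap_self, MonoidHom.comp_assoc,
        vertexMap_comp_edgeMap _ _ _ _ (g.monotone (by decide)), ← h2 (f 1) g]
    · have h3 : ∀ i j : Fin 2, i ≤ j → i ≠ j → i = 0 ∧ j = 1 := by decide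
      obtain ⟨e₀, e₁⟩ := h3 (f 0) (f 1) (f.monotone (by decide)) h
      rw [e₀, e₁]
      rfl

/-- The homomorphism `X ⋊ G → X' ⋊ G'` induced by a morphism of pre-crossed modules. -/
def onSemi {P Q : PreCrossedModule.{u}} (f : P ⟶ Q) : P.Semi →* Q.Semi :=
  SemidirectProduct.map f.onX f.onG (fun g => by
    ext x
    exact f.equivariant x g⁻¹ |>.trans (by rw [map_inv]; rfl))

/-- The components of the morphism of truncated simplicial groups induced by a morphism of
pre-crossed modules: `g ↦ f g` and `(x, g) ↦ (f x, f g)`. -/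
def onLevel {P Q : PreCrossedModule.{u}} (f : P ⟶ Q) : ∀ n : ℕ, P.level n ⟶ Q.level n
  | 0 => GrpCat.ofHom f.onG
  | _ + 1 => GrpCat.ofHom (onSemi f)

theorem onLevel_naturality {P Q : PreCrossedModule.{u}} (f : P ⟶ Q) {a b : ℕ}
    (g : Fin (a + 1) →o Fin (b + 1)) :
    P.levelMap g ≫ onLevel f a = onLevel f b ≫ Q.levelMap g := by
  have h₀ : f.onG.comp P.d₀ = Q.d₀.comp (onSemi f) := rfl
  have h₁ : f.onG.comp P.d₁ = Q.d₁.comp (onSemi f) := by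
    ext x
    exact (map_mul f.onG _ _).trans (congrArg (· * _) (f.comm _).symm)
  have hs : (onSemi f).comp P.s₀ = Q.s₀.comp f.onG := by
    ext g
    · exact map_one f.onX
    · rfl
  have hv : ∀ i : Fin (b + 1),
      f.onG.comp (P.vertexMap i) = (Q.vertexMap i).comp (onSemi f) := fun i => by
    unfold vertexMap
    split_ifs
    · exact h₁
    · exact h₀
  rcases a with _ | a <;> rcases b with _ | b
  · rfl
  · exact congrArg GrpCat.ofHom (hv _)
  · exact congrArg GrpCat.ofHom hs
  · refine congrArg GrpCat.ofHom (?_ : (onSemi f).comp (P.edgeMap (g 0) (g 1)) =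
      (Q.edgeMap (g 0) (g 1)).comp (onSemi f))
    unfold edgeMap
    split_ifs
    · rw [← MonoidHom.comp_assoc, hs, MonoidHom.comp_assoc, hv, MonoidHom.comp_assoc]
    · rfl

theorem onLevel_id (P : PreCrossedModule.{u}) (n : ℕ) : onLevel (𝟙 P) n = 𝟙 (P.level n) := by
  cases n <;> rfl

theorem onLevel_comp {P Q R : PreCrossedModule.{u}} (f : P ⟶ Q) (g : Q ⟶ R) (n : ℕ) :
    onLevel (f ≫ g) n = onLevel f n ≫ onLevel g n := by
  cases n <;> rfl

/-- The functor sending a pre-crossed module `π : X → G` to the simplicial group truncated to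
order one `X ⋊ G ⇉ G`, with `d₀ (x, g) = g`, `d₁ (x, g) = π x * g` and `s₀ g = (1, g)`. -/
def toTruncated : PreCrossedModule.{u} ⥤ SimplicialObject.Truncated GrpCat.{u} 1 where
  obj P :=
    { obj := fun n => P.level n.unop.obj.len
      map := fun f => P.levelMap f.unop.hom.toOrderHom
      map_id := fun n => P.levelMap_id n.unop.property
      map_comp := fun {a b c} f g =>
        P.levelMap_comp c.unop.property b.unop.property a.unop.property _ _ }
  map f :=
    { app := fun n => onLevel f n.unop.obj.len
      naturality := fun _ _ g => onLevel_naturality f g.unop.hom.toOrderHom }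
  map_id P := by
    ext n : 2
    exact onLevel_id P _
  map_comp f g := by
    ext n : 2
    exact onLevel_comp f g _

end PreCrossedModule

instance GrpCat.hasColimits_of_units : HasColimits GrpCat.{u} :=
  haveI : Coreflective (forget₂ GrpCat.{u} MonCat.{u}) :=
    { R := MonCat.units, adj := GrpCat.forget₂MonAdj }
  hasColimits_of_coreflective (forget₂ GrpCat.{u} MonCat.{u})

instance GrpCat.hasColimits_zero : HasColimitsOfSize.{0, 0} GrpCat.{u} :=
  hasColimitsOfSizeShrink.{0, 0} GrpCat.{u}
noncomputable section

/-- The canonical morphism from the `1`-skeleton to the `1`-coskeleton of a simplicial group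
truncated to order one. -/
def skToCosk : SimplicialObject.Truncated.sk (C := GrpCat.{u}) 1 ⟶
    SimplicialObject.Truncated.cosk (C := GrpCat.{u}) 1 :=
  Adjunction.Triple.leftToRight ⟨SimplicialObject.skAdj 1, SimplicialObject.coskAdj 1⟩

/-- The subgroup `s₀ⁿ A₀` of `Aₙ`, for a simplicial group `A`: the image of the group of vertices
`A₀` under the degeneracy operator given by the map `[n] → [0]`. -/
def degenerateVertices (A : SimplicialObject GrpCat.{u}) (n : SimplexCategoryᵒᵖ) :
    Subgroup (A.obj n) :=
  (A.map (n.unop.const (SimplexCategory.mk 0) 0).op).hom.range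

/-- The right action of `A₀` on `Aₙ` is free, as the degeneracy operator `A₀ → Aₙ` is injective. -/
theorem degeneracy_injective (A : SimplicialObject GrpCat.{u}) (n : SimplexCategoryᵒᵖ) :
    Function.Injective (A.map (n.unop.const (SimplexCategory.mk 0) 0).op).hom := by
  have h : A.map (n.unop.const (SimplexCategory.mk 0) 0).op ≫
      A.map ((SimplexCategory.mk 0).const n.unop 0).op = 𝟙 _ := by
    rw [← A.map_comp, ← A.map_id]
    congr 1
    exact Quiver.Hom.unop_inj (by ext; simp)
  exact Function.LeftInverse.injective
    (g := (A.map ((SimplexCategory.mk 0).const n.unop 0).op).hom)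
    fun x => ConcreteCategory.congr_hom h x

theorem map_mem_degenerateVertices (A : SimplicialObject GrpCat.{u}) {m n : SimplexCategoryᵒᵖ}
    (f : m ⟶ n) {a : A.obj m} (ha : a ∈ degenerateVertices A m) :
    (A.map f).hom a ∈ degenerateVertices A n := by
  obtain ⟨v, rfl⟩ := ha
  refine ⟨v, ?_⟩
  have h : (m.unop.const (SimplexCategory.mk 0) 0).op ≫ f =
      (n.unop.const (SimplexCategory.mk 0) 0).op := rfl
  rw [← h, A.map_comp]
  rfl

theorem app_mem_degenerateVertices {A B : SimplicialObject GrpCat.{u}} (φ : A ⟶ B)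
    {n : SimplexCategoryᵒᵖ} {a : A.obj n} (ha : a ∈ degenerateVertices A n) :
    (φ.app n).hom a ∈ degenerateVertices B n := by
  obtain ⟨v, rfl⟩ := ha
  exact ⟨(φ.app _).hom v, (ConcreteCategory.congr_hom
    (φ.naturality (n.unop.const (SimplexCategory.mk 0) 0).op) v).symm⟩

/-- The map of cosets induced by a homomorphism. -/
def cosetMap {A B : GrpCat.{u}} (f : A ⟶ B) (S : Subgroup A) (T : Subgroup B)
    (h : ∀ a ∈ S, f.hom a ∈ T) : A ⧸ S → B ⧸ T :=
  Quotient.map' f.hom fun a b hab => by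
    rw [QuotientGroup.leftRel_apply] at hab ⊢
    simpa using h _ hab

/-- The quotient of a simplicial group `A` by the right action of the group of vertices `A₀`, which
acts on `Aₙ` by multiplication on the right with the elements of `s₀ⁿ A₀`. The `n`-simplices are
the orbits `a * s₀ⁿ A₀`. -/
def quotientByVertices : SimplicialObject GrpCat.{u} ⥤ SSet.{u} where
  obj A :=
    { obj := fun n => A.obj n ⧸ degenerateVertices A n
      map := fun f => TypeCat.ofHom (cosetMap (A.map f) _ _
        fun _ ha => map_mem_degenerateVertices A f ha)
      map_id := fun n => by
        ext a
        induction a using QuotientGroup.induction_on with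
        | H a => exact congrArg QuotientGroup.mk (by simp)
      map_comp := fun f g => by
        ext a
        induction a using QuotientGroup.induction_on with
        | H a => exact congrArg QuotientGroup.mk (by simp) }
  map φ :=
    { app := fun n => TypeCat.ofHom (cosetMap (φ.app n) _ _
        fun _ ha => app_mem_degenerateVertices φ ha)
      naturality := fun m n f => by
        ext a
        induction a using QuotientGroup.induction_on with
        | H a => exact congrArg QuotientGroup.mk
                  (ConcreteCategory.congr_hom (φ.naturality f) a) }
  map_id A := by
    ext n a
    induction a using QuotientGroup.induction_on with
    | H a => rfl
  map_comp φ ψ := by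
    ext n a
    induction a using QuotientGroup.induction_on with
    | H a => rfl

/-- The functor `G ↦ Hₘ(G; k)`, the group homology with trivial coefficients `k`. -/
def groupHomologyFunctor (k : Type u) [CommRing k] (m : ℕ) : GrpCat.{u} ⥤ ModuleCat.{u} k where
  obj G := groupHomology (Rep.trivial k G k) m
  map {G H} f := groupHomology.map f.hom
    (show Rep.trivial k G k ⟶ Rep.res f.hom (Rep.trivial k H k) from 𝟙 (Rep.trivial k G k)) m
  map_id G := groupHomology.map_id (A := Rep.trivial k G k) m
  map_comp {G H K} f g := by
    rw [← groupHomology.map_comp]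
    rfl

namespace PreCrossedModule

/-- The universal simplicial envelope `E_*(X, G, π)`: the `1`-skeleton (the value of the left
adjoint of the truncation functor) of the truncated simplicial group `X ⋊ G ⇉ G`. -/
def skeleton : PreCrossedModule.{u} ⥤ SimplicialObject GrpCat.{u} :=
  toTruncated ⋙ SimplicialObject.Truncated.sk 1

/-- `M_*(X, G, π)`: the `1`-coskeleton (the value of the right adjoint of the truncation functor)
of the truncated simplicial group `X ⋊ G ⇉ G`. -/
def coskeleton : PreCrossedModule.{u} ⥤ SimplicialObject GrpCat.{u} :=
  toTruncated ⋙ SimplicialObject.Truncated.cosk 1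

/-- The canonical morphism `E_*(X, G, π) ⟶ M_*(X, G, π)`. -/
def canonicalMap : skeleton.{u} ⟶ coskeleton.{u} :=
  Functor.whiskerLeft toTruncated skToCosk

/-- The identification of the group of vertices of `M_*(X, G, π)` with `G`. -/
def vertexGroupHom (P : PreCrossedModule.{u}) :
    (coskeleton.obj P).obj (op (SimplexCategory.mk 0)) ⟶ GrpCat.of P.G :=
  ((SimplicialObject.coskAdj 1).counit.app (toTruncated.obj P)).app
    (op ⟨SimplexCategory.mk 0, Nat.zero_le 1⟩)

theorem isIso_vertexGroupHom (P : PreCrossedModule.{u}) : IsIso (vertexGroupHom P) :=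
  inferInstanceAs (IsIso ((asIso ((SimplicialObject.coskAdj 1).counit.app
    (toTruncated.obj P))).app (op ⟨SimplexCategory.mk 0, Nat.zero_le 1⟩)).hom)

/-- The identification of `G` with the group of vertices of `E_*(X, G, π)`. -/
def skeletonVertexIso (P : PreCrossedModule.{u}) :
    GrpCat.of P.G ≅ (skeleton.obj P).obj (op (SimplexCategory.mk 0)) :=
  (asIso ((SimplicialObject.skAdj 1).unit.app (toTruncated.obj P))).app
    (op ⟨SimplexCategory.mk 0, Nat.zero_le 1⟩)

/-- The `i`-th vertex, as an element of `G`, of an `n`-simplex of `M_*(X, G, π)`. -/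
def vertex (P : PreCrossedModule.{u}) {n : ℕ}
    (σ : (coskeleton.obj P).obj (op (SimplexCategory.mk n))) (i : Fin (n + 1)) : P.G :=
  (vertexGroupHom P).hom
    (((coskeleton.obj P).map ((SimplexCategory.mk 0).const (SimplexCategory.mk n) i).op).hom σ)

/-- The simplicial set `M_*(X, G, π) / G`, where `G` is the group of vertices of
`M_*(X, G, π)`. -/
def coskeletonQuotient : PreCrossedModule.{u} ⥤ SSet.{u} :=
  coskeleton ⋙ quotientByVertices

/-- The pre-crossed homology `PHₘ(X, G, π) = Hₘ(E_*(X, G, π) / G)` with coefficients in `k`.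
Here `G` is the group of vertices of `E_*(X, G, π)`, see `skeletonVertexIso`. -/
def PH (k : Type u) [CommRing k] (m : ℕ) : PreCrossedModule.{u} ⥤ ModuleCat.{u} k :=
  skeleton ⋙ quotientByVertices ⋙ SSet.homologyFunctor (ModuleCat.of k k) m

/-- The homology `Hₘ(M_*(X, G, π) / G)` with coefficients in `k`. -/
def coskeletonHomology (k : Type u) [CommRing k] (m : ℕ) :
    PreCrossedModule.{u} ⥤ ModuleCat.{u} k :=
  coskeletonQuotient ⋙ SSet.homologyFunctor (ModuleCat.of k k) m

/-- The map `Hₘ(E_* / G) ⟶ Hₘ(M_* / G)` induced by the canonical morphism `E_* ⟶ M_*`. -/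
def canonicalHomologyMap (k : Type u) [CommRing k] (m : ℕ) :
    PH.{u} k m ⟶ coskeletonHomology.{u} k m :=
  Functor.whiskerRight canonicalMap
    (quotientByVertices ⋙ SSet.homologyFunctor (ModuleCat.of k k) m)

/-- The underlying simplicial set of `M_*(X, G, π)`. -/
def coskeletonSSet (P : PreCrossedModule.{u}) : SSet.{u} :=
  ((SimplicialObject.whiskering GrpCat.{u} (Type u)).obj (forget GrpCat.{u})).obj
    (coskeleton.obj P)

/-- The vertex of `M_*(X, G, π)` given by the neutral element of the group of vertices. -/
def baseVertex (P : PreCrossedModule.{u}) : P.coskeletonSSet.obj (op (SimplexCategory.mk 0)) :=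
  (1 : (coskeleton.obj P).obj (op (SimplexCategory.mk 0)))

end PreCrossedModule

end

/-! A `1`-coskeleton carries no information above dimension one. So an `n`-simplex of `M_*` is the
same as vertices `v i` in `G` and elements `x i j` of `X` for `i ≤ j`, subject only to `x i i = 1`
and `π (x i j) * v j = v i`; triangles impose no condition (`coskeleton_ext`,
`exists_vertex_edge_eq`). Multiplying by a degenerate vertex `g` on the right turns `v i` into `v i
* g` and leaves every `x i j` alone (`leftRel_iff`). Hence the quotients `v i * (v (i+1))⁻¹` are
functions on the orbits. Faces act on them as in the bar complex (`barCoord_δ_zero`,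
`barCoord_δ_succ`), which gives the chain map behind `κ`; `θ` is defined as its composite with the
canonical map.

If `π` is surjective, an edge can be chosen between any two vertices, and no higher coherence has to
be checked, so homotopies can be written down freely (`deformation`). Moving every vertex to `1`
contracts `M_*`, but this is not `G`-equivariant. A second homotopy fixes the vertices and replaces
each edge by `t (v i * (v j)⁻¹)`, for a section `t` of `π` with `t 1 = 1`. It descends to `M_* / G`
and deforms the identity to `rectify`, whose value depends only on the bar coordinates. Lifting bar
coordinates to a simplex and rectifying it therefore gives a one-sided inverse of the classifying
chain map on the nose, while the other composite is `rectify`, which is homotopic to the identity.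
-/

noncomputable section

namespace PreCrossedModule

/-! ### The coskeleton as a pointwise limit over maps `[a] → [n]` with `a ≤ 1`. -/

variable (P : PreCrossedModule.{u})

/-- In each degree, the coskeleton is a limit of the truncated simplicial group. -/
def isLimitCoskeletonConeAt (n : SimplexCategoryᵒᵖ) :
    IsLimit ((Functor.RightExtension.mk (coskeleton.obj P)
      ((SimplicialObject.coskAdj 1).counit.app (toTruncated.obj P))).coneAt n) :=
  haveI : (coskeleton.obj P).IsRightKanExtension
      ((SimplicialObject.coskAdj 1).counit.app (toTruncated.obj P)) := by
    dsimp only [SimplicialObject.coskAdj]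
    rw [Functor.ranAdjunction_counit]
    exact inferInstanceAs (((SimplexCategory.Truncated.inclusion 1).op.ran.obj
      (toTruncated.obj P)).IsRightKanExtension _)
  Functor.isPointwiseRightKanExtensionOfIsRightKanExtension _ _ n

/-- The identification of the `a`-simplices of `M_*(X, G, π)` with those of the truncated
simplicial group `X ⋊ G ⇉ G`, for `a ≤ 1`. -/
def lowDegreeHom (a : ℕ) (ha : a ≤ 1) :
    (coskeleton.obj P).obj (op (SimplexCategory.mk a)) ⟶ P.level a :=
  ((SimplicialObject.coskAdj 1).counit.app (toTruncated.obj P)).app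
    (op ⟨SimplexCategory.mk a, ha⟩)

/-- The restriction of an `n`-simplex of `M_*(X, G, π)` along `[a] → [n]`, `a ≤ 1`, as an element
of the truncated simplicial group `X ⋊ G ⇉ G`. -/
def restrict {n : ℕ} (a : ℕ) (ha : a ≤ 1) (f : SimplexCategory.mk a ⟶ SimplexCategory.mk n) :
    (coskeleton.obj P).obj (op (SimplexCategory.mk n)) →* P.level a :=
  (P.lowDegreeHom a ha).hom.comp ((coskeleton.obj P).map f.op).hom

variable {P}

theorem coskeleton_map_comp_apply {l m n : ℕ}
    (f : SimplexCategory.mk l ⟶ SimplexCategory.mk m)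
    (g : SimplexCategory.mk m ⟶ SimplexCategory.mk n)
    (σ : (coskeleton.obj P).obj (op (SimplexCategory.mk n))) :
    ((coskeleton.obj P).map (f ≫ g).op).hom σ =
      ((coskeleton.obj P).map f.op).hom (((coskeleton.obj P).map g.op).hom σ) :=
  ConcreteCategory.congr_hom ((coskeleton.obj P).map_comp g.op f.op) σ

theorem restrict_map {m n a : ℕ} (ha : a ≤ 1)
    (f : SimplexCategory.mk a ⟶ SimplexCategory.mk m)
    (g : SimplexCategory.mk m ⟶ SimplexCategory.mk n)
    (σ : (coskeleton.obj P).obj (op (SimplexCategory.mk n))) :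
    P.restrict a ha f (((coskeleton.obj P).map g.op).hom σ) = P.restrict a ha (f ≫ g) σ :=
  congrArg (P.lowDegreeHom a ha).hom (coskeleton_map_comp_apply f g σ).symm

/-- This is naturality of the counit of the coskeleton adjunction, read in the truncated simplicial
group. -/
theorem restrict_comp {n a b : ℕ} (ha : a ≤ 1) (hb : b ≤ 1)
    (f : SimplexCategory.mk a ⟶ SimplexCategory.mk n)
    (h : SimplexCategory.mk b ⟶ SimplexCategory.mk a)
    (σ : (coskeleton.obj P).obj (op (SimplexCategory.mk n))) :
    P.restrict b hb (h ≫ f) σ = (P.levelMap h.toOrderHom).hom (P.restrict a ha f σ) := by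
  have := ((SimplicialObject.coskAdj 1).counit.app (toTruncated.obj P)).naturality
    (X := op ⟨SimplexCategory.mk a, ha⟩) (Y := op ⟨SimplexCategory.mk b, hb⟩)
    (Quiver.Hom.op (ObjectProperty.homMk h))
  exact (congrArg (P.lowDegreeHom b hb).hom (coskeleton_map_comp_apply h f σ)).trans
    (ConcreteCategory.congr_hom this (((coskeleton.obj P).map f.op).hom σ))

/-- The forgetful functor preserves the limit, so a simplex is a compatible family indexed by the
structured arrows under `[n]`, and these are the maps `[a] → [n]` with `a ≤ 1`. -/
theorem restrict_ext {n : ℕ} {σ τ : (coskeleton.obj P).obj (op (SimplexCategory.mk n))}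
    (h : ∀ (a : ℕ) (ha : a ≤ 1) (f : SimplexCategory.mk a ⟶ SimplexCategory.mk n),
      P.restrict a ha f σ = P.restrict a ha f τ) : σ = τ := by
  let e := Types.isLimitEquivSections (isLimitOfPreserves (forget GrpCat.{u})
    (isLimitCoskeletonConeAt P (op (SimplexCategory.mk n))))
  apply e.injective
  refine Subtype.ext (funext fun j => ?_)
  exact h j.right.unop.obj.len j.right.unop.property j.hom.unop

theorem exists_restrict_eq {n : ℕ}
    (s : ∀ a : ℕ, (SimplexCategory.mk a ⟶ SimplexCategory.mk n) → P.level a)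
    (hs : ∀ (a b : ℕ) (_ : a ≤ 1) (_ : b ≤ 1) (f : SimplexCategory.mk a ⟶ SimplexCategory.mk n)
      (h : SimplexCategory.mk b ⟶ SimplexCategory.mk a),
      s b (h ≫ f) = (P.levelMap h.toOrderHom).hom (s a f)) :
    ∃ σ : (coskeleton.obj P).obj (op (SimplexCategory.mk n)),
      ∀ (a : ℕ) (ha : a ≤ 1) (f : SimplexCategory.mk a ⟶ SimplexCategory.mk n),
        P.restrict a ha f σ = s a f := by
  let e := Types.isLimitEquivSections (isLimitOfPreserves (forget GrpCat.{u})
    (isLimitCoskeletonConeAt P (op (SimplexCategory.mk n))))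
  refine ⟨e.symm ⟨fun j => s j.right.unop.obj.len j.hom.unop, ?_⟩, fun a ha f => ?_⟩
  · intro i j g
    have w : i.hom ≫ (SimplexCategory.Truncated.inclusion 1).op.map g.right = j.hom :=
      StructuredArrow.w g
    exact ((congrArg (fun t => s _ t.unop) w).symm.trans
      (hs _ _ i.right.unop.property j.right.unop.property i.hom.unop g.right.unop.hom)).symm
  · exact congr_fun (congr_arg Subtype.val (e.apply_symm_apply
      ⟨fun j => s j.right.unop.obj.len j.hom.unop, _⟩))
      (StructuredArrow.mk (T := (SimplexCategory.Truncated.inclusion 1).op)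
        (Y := (op ⟨SimplexCategory.mk a, ha⟩ : (SimplexCategory.Truncated 1)ᵒᵖ)) f.op)

/-! ### Coordinates on simplices: vertices in `G` and edges in `X`. -/

/-- For an `n`-simplex of `M_*(X, G, π)` and `i ≤ j`, the component in `X` of the `1`-simplex
which is spanned by the vertices `i` and `j` (and `1` if `j < i`). -/
def edge (P : PreCrossedModule.{u}) {n : ℕ}
    (σ : (coskeleton.obj P).obj (op (SimplexCategory.mk n))) (i j : Fin (n + 1)) : P.X :=
  if h : i ≤ j then
    SemidirectProduct.left (P.restrict 1 le_rfl (SimplexCategory.mkOfLe i j h) σ : P.Semi)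
  else 1

theorem d₀_restrict {n : ℕ} (σ : (coskeleton.obj P).obj (op (SimplexCategory.mk n)))
    (f : SimplexCategory.mk 1 ⟶ SimplexCategory.mk n) :
    P.d₀ (P.restrict 1 le_rfl f σ) = P.vertex σ (f.toOrderHom 1) :=
  (restrict_comp le_rfl (Nat.zero_le 1) f
    ((SimplexCategory.mk 0).const (SimplexCategory.mk 1) 1) σ).symm

theorem d₁_restrict {n : ℕ} (σ : (coskeleton.obj P).obj (op (SimplexCategory.mk n)))
    (f : SimplexCategory.mk 1 ⟶ SimplexCategory.mk n) :
    P.d₁ (P.restrict 1 le_rfl f σ) = P.vertex σ (f.toOrderHom 0) :=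
  (restrict_comp le_rfl (Nat.zero_le 1) f
    ((SimplexCategory.mk 0).const (SimplexCategory.mk 1) 0) σ).symm

theorem restrict_const {n : ℕ} (σ : (coskeleton.obj P).obj (op (SimplexCategory.mk n)))
    (i : Fin (n + 1)) :
    P.restrict 1 le_rfl ((SimplexCategory.mk 1).const (SimplexCategory.mk n) i) σ =
      P.s₀ (P.vertex σ i) :=
  restrict_comp (Nat.zero_le 1) le_rfl ((SimplexCategory.mk 0).const (SimplexCategory.mk n) i)
    ((SimplexCategory.mk 1).const (SimplexCategory.mk 0) 0) σ

theorem edge_eq {n : ℕ} (σ : (coskeleton.obj P).obj (op (SimplexCategory.mk n)))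
    (f : SimplexCategory.mk 1 ⟶ SimplexCategory.mk n) :
    P.edge σ (f.toOrderHom 0) (f.toOrderHom 1) =
      SemidirectProduct.left (P.restrict 1 le_rfl f σ : P.Semi) := by
  have h : f.toOrderHom 0 ≤ f.toOrderHom 1 := f.toOrderHom.monotone (Fin.zero_le 1)
  have hf : SimplexCategory.mkOfLe _ _ h = f := SimplexCategory.Hom.ext_one_left _ _
  rw [edge, dif_pos h, hf]

theorem restrict_one_eq {n : ℕ} (σ : (coskeleton.obj P).obj (op (SimplexCategory.mk n)))
    (f : SimplexCategory.mk 1 ⟶ SimplexCategory.mk n) :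
    P.restrict 1 le_rfl f σ = (⟨P.edge σ (f.toOrderHom 0) (f.toOrderHom 1),
      P.vertex σ (f.toOrderHom 1)⟩ : P.Semi) :=
  SemidirectProduct.ext (edge_eq σ f).symm (d₀_restrict σ f)

theorem edge_self {n : ℕ} (σ : (coskeleton.obj P).obj (op (SimplexCategory.mk n)))
    (i : Fin (n + 1)) : P.edge σ i i = 1 := by
  have h := edge_eq σ ((SimplexCategory.mk 1).const (SimplexCategory.mk n) i)
  rw [restrict_const] at h
  exact h

theorem π_edge_mul_vertex {n : ℕ} (σ : (coskeleton.obj P).obj (op (SimplexCategory.mk n)))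
    {i j : Fin (n + 1)} (h : i ≤ j) : P.π (P.edge σ i j) * P.vertex σ j = P.vertex σ i := by
  have h1 := d₁_restrict σ (SimplexCategory.mkOfLe i j h)
  rw [restrict_one_eq] at h1
  exact h1

/-- A map `[0] → [n]` picks a vertex, and a map `[1] → [n]` picks a pair `i ≤ j`, whose restriction
consists of an edge and its end vertex. -/
theorem coskeleton_ext {n : ℕ} {σ τ : (coskeleton.obj P).obj (op (SimplexCategory.mk n))}
    (hv : ∀ i, P.vertex σ i = P.vertex τ i)
    (he : ∀ i j, i ≤ j → P.edge σ i j = P.edge τ i j) : σ = τ := by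
  refine restrict_ext fun a ha f => ?_
  obtain rfl | rfl : a = 0 ∨ a = 1 := by omega
  · have hf : f = (SimplexCategory.mk 0).const (SimplexCategory.mk n) (f.toOrderHom 0) :=
      SimplexCategory.Hom.ext_zero_left _ _
    rw [hf]
    exact hv _
  · rw [restrict_one_eq, restrict_one_eq, hv,
      he _ _ (f.toOrderHom.monotone (Fin.zero_le 1))]

/-- The two hypotheses are what compatibility with the operators between `[0]` and `[1]` amounts to:
`h₁` for the degeneracy and `h₂` for the face `d₁`; the face `d₀` holds by construction. -/
theorem exists_vertex_edge_eq {n : ℕ} (v : Fin (n + 1) → P.G) (x : Fin (n + 1) → Fin (n + 1) → P.X)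
    (h₁ : ∀ i, x i i = 1) (h₂ : ∀ i j, i ≤ j → P.π (x i j) * v j = v i) :
    ∃ σ : (coskeleton.obj P).obj (op (SimplexCategory.mk n)),
      (∀ i, P.vertex σ i = v i) ∧ ∀ i j, i ≤ j → P.edge σ i j = x i j := by
  -- Only `a = 0` and `a = 1` matter; the values in higher degrees are fillers, as in `level`.
  let s : ∀ a : ℕ, (SimplexCategory.mk a ⟶ SimplexCategory.mk n) → P.level a := fun a =>
    match a with
    | 0 => fun f => v (f.toOrderHom 0)
    | _ + 1 => fun f =>
      (⟨x (f.toOrderHom 0) (f.toOrderHom 1), v (f.toOrderHom 1)⟩ : P.Semi)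
  obtain ⟨σ, hσ⟩ := exists_restrict_eq s (fun a b ha hb f h => by
    have hk : ∀ i : Fin 1, i = 0 := by decide
    obtain rfl | rfl : a = 0 ∨ a = 1 := by omega
    · obtain rfl | rfl : b = 0 ∨ b = 1 := by omega
      · exact congrArg (fun i => v (f.toOrderHom i)) (hk (h.toOrderHom 0))
      · refine SemidirectProduct.ext ((?_ : x (f.toOrderHom (h.toOrderHom 0))
          (f.toOrderHom (h.toOrderHom 1)) = 1))
          (congrArg (fun i => v (f.toOrderHom i)) (hk (h.toOrderHom 1)))
        rw [hk (h.toOrderHom 0), hk (h.toOrderHom 1), h₁]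
    · obtain ⟨p, q, hpq, rfl⟩ : ∃ p q, ∃ hpq : p ≤ q, f = SimplexCategory.mkOfLe p q hpq :=
        ⟨_, _, f.toOrderHom.monotone (Fin.zero_le 1), SimplexCategory.Hom.ext_one_left _ _⟩
      have hv : ∀ i : Fin 2, v ((SimplexCategory.mkOfLe p q hpq).toOrderHom i) =
          P.vertexMap i (⟨x p q, v q⟩ : P.Semi) := fun i => by
        fin_cases i
        · exact (h₂ p q hpq).symm
        · rfl
      obtain rfl | rfl : b = 0 ∨ b = 1 := by omega
      · exact hv _
      · change (⟨x ((SimplexCategory.mkOfLe p q hpq).toOrderHom (h.toOrderHom 0))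
          ((SimplexCategory.mkOfLe p q hpq).toOrderHom (h.toOrderHom 1)),
          v ((SimplexCategory.mkOfLe p q hpq).toOrderHom (h.toOrderHom 1))⟩ : P.Semi) =
          P.edgeMap (h.toOrderHom 0) (h.toOrderHom 1) (⟨x p q, v q⟩ : P.Semi)
        have h3 : ∀ i j : Fin 2, i ≤ j → i ≠ j → i = 0 ∧ j = 1 := by decide
        by_cases e : h.toOrderHom 0 = h.toOrderHom 1
        · rw [e, edgeMap_self, h₁, hv]
          rfl
        -- A non-constant monotone map `[1] → [1]` is the identity.
        · obtain ⟨e₀, e₁⟩ := h3 _ _ (h.toOrderHom.monotone (Fin.zero_le 1)) e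
          rw [e₀, e₁]
          rfl)
  refine ⟨σ, fun i => hσ 0 (Nat.zero_le 1) _, fun i j h => ?_⟩
  have h5 := hσ 1 le_rfl (SimplexCategory.mkOfLe i j h)
  rw [restrict_one_eq] at h5
  exact congrArg SemidirectProduct.left h5

/-- The `n`-simplex of `M_*(X, G, π)` with given vertices and edges. -/
def ofEdges {n : ℕ} (v : Fin (n + 1) → P.G) (x : Fin (n + 1) → Fin (n + 1) → P.X)
    (h₁ : ∀ i, x i i = 1) (h₂ : ∀ i j, i ≤ j → P.π (x i j) * v j = v i) :
    (coskeleton.obj P).obj (op (SimplexCategory.mk n)) :=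
  (exists_vertex_edge_eq v x h₁ h₂).choose

section ofEdges

variable {n : ℕ} (v : Fin (n + 1) → P.G) (x : Fin (n + 1) → Fin (n + 1) → P.X)
    (h₁ : ∀ i, x i i = 1) (h₂ : ∀ i j, i ≤ j → P.π (x i j) * v j = v i)

theorem vertex_ofEdges (i : Fin (n + 1)) : P.vertex (ofEdges v x h₁ h₂) i = v i :=
  (exists_vertex_edge_eq v x h₁ h₂).choose_spec.1 i

theorem edge_ofEdges {i j : Fin (n + 1)} (h : i ≤ j) :
    P.edge (ofEdges v x h₁ h₂) i j = x i j :=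
  (exists_vertex_edge_eq v x h₁ h₂).choose_spec.2 i j h

end ofEdges

/-! ### Operators, products and functoriality in these coordinates. -/

theorem vertex_map {m n : ℕ} (f : SimplexCategory.mk m ⟶ SimplexCategory.mk n)
    (σ : (coskeleton.obj P).obj (op (SimplexCategory.mk n))) (i : Fin (m + 1)) :
    P.vertex (((coskeleton.obj P).map f.op).hom σ) i = P.vertex σ (f.toOrderHom i) :=
  restrict_map _ _ _ _

theorem edge_map {m n : ℕ} (f : SimplexCategory.mk m ⟶ SimplexCategory.mk n)
    (σ : (coskeleton.obj P).obj (op (SimplexCategory.mk n))) {i j : Fin (m + 1)} (h : i ≤ j) :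
    P.edge (((coskeleton.obj P).map f.op).hom σ) i j =
      P.edge σ (f.toOrderHom i) (f.toOrderHom j) := by
  have h1 : f.toOrderHom i ≤ f.toOrderHom j := f.toOrderHom.monotone h
  rw [edge, dif_pos h, restrict_map, edge, dif_pos h1]
  congr 3
  exact SimplexCategory.Hom.ext_one_left _ _

theorem vertex_mul {n : ℕ} (σ τ : (coskeleton.obj P).obj (op (SimplexCategory.mk n)))
    (i : Fin (n + 1)) : P.vertex (σ * τ) i = P.vertex σ i * P.vertex τ i :=
  map_mul (P.restrict 0 _ _) σ τ

theorem vertex_one {n : ℕ} (i : Fin (n + 1)) :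
    P.vertex (1 : (coskeleton.obj P).obj (op (SimplexCategory.mk n))) i = 1 :=
  map_one (P.restrict 0 _ _)

theorem edge_one {n : ℕ} (i j : Fin (n + 1)) :
    P.edge (1 : (coskeleton.obj P).obj (op (SimplexCategory.mk n))) i j = 1 := by
  unfold edge
  split_ifs
  · rw [map_one]
    rfl
  · rfl

theorem vertex_mul_degenerate {n : ℕ} (σ : (coskeleton.obj P).obj (op (SimplexCategory.mk n)))
    (g : (coskeleton.obj P).obj (op (SimplexCategory.mk 0))) (i : Fin (n + 1)) :
    P.vertex (σ * ((coskeleton.obj P).map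
      ((SimplexCategory.mk n).const (SimplexCategory.mk 0) 0).op).hom g) i =
      P.vertex σ i * P.vertex g 0 := by
  rw [vertex_mul, vertex_map]
  rfl

/-- In the semidirect product `(x, h) * (1, g) = (x, h * g)`, because automorphisms fix `1`. -/
theorem edge_mul_degenerate {n : ℕ} (σ : (coskeleton.obj P).obj (op (SimplexCategory.mk n)))
    (g : (coskeleton.obj P).obj (op (SimplexCategory.mk 0))) (i j : Fin (n + 1)) :
    P.edge (σ * ((coskeleton.obj P).map
      ((SimplexCategory.mk n).const (SimplexCategory.mk 0) 0).op).hom g) i j = P.edge σ i j := by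
  unfold edge
  split_ifs with h
  · rw [map_mul, restrict_map]
    have h1 : SimplexCategory.mkOfLe i j h ≫
        (SimplexCategory.mk n).const (SimplexCategory.mk 0) 0 =
        (SimplexCategory.mk 1).const (SimplexCategory.mk 0) 0 := rfl
    rw [h1, restrict_const]
    refine (SemidirectProduct.mul_left (G := P.G) _ _).trans ?_
    erw [SemidirectProduct.left_inr, map_one, mul_one]
  · rfl

theorem vertex_app {P Q : PreCrossedModule.{u}} (φ : P ⟶ Q) {n : ℕ}
    (σ : (coskeleton.obj P).obj (op (SimplexCategory.mk n))) (i : Fin (n + 1)) :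
    Q.vertex (((coskeleton.map φ).app (op (SimplexCategory.mk n))).hom σ) i =
      φ.onG (P.vertex σ i) := by
  have h1 := ConcreteCategory.congr_hom ((coskeleton.map φ).naturality
    ((SimplexCategory.mk 0).const (SimplexCategory.mk n) i).op) σ
  have h2 := congr_app ((SimplicialObject.coskAdj 1).counit.naturality (toTruncated.map φ))
    (op ⟨SimplexCategory.mk 0, Nat.zero_le 1⟩)
  exact (congrArg (vertexGroupHom Q).hom h1.symm).trans (ConcreteCategory.congr_hom h2 _)

end PreCrossedModule

namespace PreCrossedModule

/-! ### Orbits of `G`, and maps into the coskeleton. -/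

open MonoidalCategory Simplicial

variable {P : PreCrossedModule.{u}}

theorem leftRel_iff {n : ℕ} (σ τ : (coskeleton.obj P).obj (op (SimplexCategory.mk n))) :
    QuotientGroup.leftRel (degenerateVertices (coskeleton.obj P) (op (SimplexCategory.mk n))) σ τ ↔
      ∃ g : P.G, (∀ i, P.vertex τ i = P.vertex σ i * g) ∧
        ∀ i j, i ≤ j → P.edge τ i j = P.edge σ i j := by
  rw [QuotientGroup.leftRel_apply]
  constructor
  · rintro ⟨g, hg⟩
    rw [eq_inv_mul_iff_mul_eq] at hg
    subst hg
    exact ⟨P.vertex g 0, fun i => vertex_mul_degenerate _ _ _,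
      fun i j _ => edge_mul_degenerate _ _ _ _⟩
  · rintro ⟨g, hv, he⟩
    -- The degenerate factor comes from the `0`-simplex with vertex `g`; equality is then checked in
    -- coordinates.
    refine ⟨ofEdges (fun _ => g) (fun _ _ => 1) (by simp) (by simp), ?_⟩
    rw [eq_inv_mul_iff_mul_eq]
    refine coskeleton_ext (fun i => ?_) fun i j h => ?_
    · exact (vertex_mul_degenerate _ _ _).trans
        ((congrArg _ (vertex_ofEdges _ _ _ _ _)).trans (hv i).symm)
    · exact (edge_mul_degenerate _ _ _ _).trans (he i j h).symm

/-- A morphism from a simplicial set to `M_*(X, G, π)` is given by a compatible family of vertices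
and edges. -/
def homOfEdges {K : SSet.{u}} (v : ∀ n : SimplexCategoryᵒᵖ, K.obj n → Fin (n.unop.len + 1) → P.G)
    (x : ∀ n : SimplexCategoryᵒᵖ, K.obj n → Fin (n.unop.len + 1) → Fin (n.unop.len + 1) → P.X)
    (h₁ : ∀ n a i, x n a i i = 1) (h₂ : ∀ n a i j, i ≤ j → P.π (x n a i j) * v n a j = v n a i)
    (hv : ∀ (m n : SimplexCategoryᵒᵖ) (f : m ⟶ n) (a : K.obj m) i,
      v n (K.map f a) i = v m a (f.unop.toOrderHom i))
    (hx : ∀ (m n : SimplexCategoryᵒᵖ) (f : m ⟶ n) (a : K.obj m) i j, i ≤ j →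
      x n (K.map f a) i j = x m a (f.unop.toOrderHom i) (f.unop.toOrderHom j)) :
    K ⟶ P.coskeletonSSet where
  app n := TypeCat.ofHom fun a => ofEdges (v n a) (x n a) (h₁ n a) (h₂ n a)
  naturality m n f := by
    ext a
    refine coskeleton_ext (fun i => ?_) fun i j h => ?_
    · refine (vertex_ofEdges _ _ (h₁ n _) (h₂ n _) i).trans ((hv m n f a i).trans ?_)
      exact ((vertex_map f.unop _ i).trans (vertex_ofEdges _ _ (h₁ m a) (h₂ m a) _)).symm
    · refine (edge_ofEdges _ _ (h₁ n _) (h₂ n _) h).trans ((hx m n f a i j h).trans ?_)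
      exact ((edge_map f.unop _ h).trans
        (edge_ofEdges _ _ (h₁ m a) (h₂ m a) (f.unop.toOrderHom.monotone h))).symm

section homOfEdges

variable {K : SSet.{u}} (v : ∀ n : SimplexCategoryᵒᵖ, K.obj n → Fin (n.unop.len + 1) → P.G)
  (x : ∀ n : SimplexCategoryᵒᵖ, K.obj n → Fin (n.unop.len + 1) → Fin (n.unop.len + 1) → P.X)
  (h₁ : ∀ n a i, x n a i i = 1) (h₂ : ∀ n a i j, i ≤ j → P.π (x n a i j) * v n a j = v n a i)
  (hv : ∀ (m n : SimplexCategoryᵒᵖ) (f : m ⟶ n) (a : K.obj m) i,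
    v n (K.map f a) i = v m a (f.unop.toOrderHom i))
  (hx : ∀ (m n : SimplexCategoryᵒᵖ) (f : m ⟶ n) (a : K.obj m) i j, i ≤ j →
    x n (K.map f a) i j = x m a (f.unop.toOrderHom i) (f.unop.toOrderHom j))

theorem vertex_homOfEdges {n : ℕ} (a : K.obj (op (SimplexCategory.mk n))) (i : Fin (n + 1)) :
    P.vertex (n := n) ((homOfEdges v x h₁ h₂ hv hx).app (op (SimplexCategory.mk n)) a) i =
      v _ a i :=
  vertex_ofEdges _ _ (h₁ _ a) (h₂ _ a) i

theorem edge_homOfEdges {n : ℕ} (a : K.obj (op (SimplexCategory.mk n))) {i j : Fin (n + 1)}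
    (h : i ≤ j) :
    P.edge (n := n) ((homOfEdges v x h₁ h₂ hv hx).app (op (SimplexCategory.mk n)) a) i j =
      x _ a i j :=
  edge_ofEdges _ _ (h₁ _ a) (h₂ _ a) h

end homOfEdges

/-! ### Homotopies prescribed on vertices and edges; the contraction. -/

/-- The monotone map `[n] → [1]` that corresponds to an `n`-simplex of `Δ[1]`. -/
def cut {n : SimplexCategoryᵒᵖ} (a : (Δ[1] : SSet.{u}).obj n) : Fin (n.unop.len + 1) →o Fin 2 :=
  (SSet.stdSimplex.objEquiv a).toOrderHom

variable (b : P.G → P.G) (e : P.G → P.G → P.X) (he : ∀ v w, P.π (e v w) * b w = v)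
  (e' : P.G → P.G → P.X) (he' : ∀ v w, P.π (e' v w) * b w = b v) (he'' : ∀ v, e' v v = 1)

/-- The homotopy on `M_*(X, G, π)` which moves the vertices `v` to the vertices `b v`, where the
edge from `v` to `b w` has the component `e v w` in `X` and the edge from `b v` to `b w` has the
component `e' v w`. -/
def deformation :
    P.coskeletonSSet ⊗ Δ[1] ⟶ P.coskeletonSSet :=
  homOfEdges
    (fun n a i => if cut a.2 i = (0 : Fin 2) then P.vertex (n := n.unop.len) a.1 i
      else b (P.vertex (n := n.unop.len) a.1 i))
    (fun n a i j => if cut a.2 j = (0 : Fin 2) then P.edge (n := n.unop.len) a.1 i j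
      else if cut a.2 i = (0 : Fin 2) then
        e (P.vertex (n := n.unop.len) a.1 i) (P.vertex (n := n.unop.len) a.1 j)
      else e' (P.vertex (n := n.unop.len) a.1 i) (P.vertex (n := n.unop.len) a.1 j))
    (fun n a i => by
      split_ifs
      · exact edge_self _ _
      · exact he'' _)
    (fun n a i j h => by
      have hij : cut a.2 i ≤ cut a.2 j := (cut a.2).monotone h
      split_ifs with h1 h2 h2
      · exact π_edge_mul_vertex _ h
      -- Excluded by monotonicity: a moved vertex cannot precede an unmoved one.
      · rw [h1] at hij
        exact absurd (Fin.le_zero_iff.1 hij) h2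
      · exact he _ _
      · exact he' _ _)
    (fun _ _ f a i => by
      have h1 := vertex_map (P := P) f.unop a.1 i
      dsimp only
      erw [h1]
      rfl)
    (fun _ _ f a i j h => by
      have h1 := vertex_map (P := P) f.unop a.1
      have h2 := edge_map (P := P) f.unop a.1 h
      dsimp only
      erw [h1 i, h1 j, h2]
      rfl)

theorem vertex_deformation {n : ℕ} (a : (P.coskeletonSSet ⊗ Δ[1]).obj (op (SimplexCategory.mk n)))
    (i : Fin (n + 1)) :
    P.vertex (n := n) ((deformation b e he e' he' he'').app (op (SimplexCategory.mk n)) a) i =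
      if cut a.2 i = (0 : Fin 2) then P.vertex (n := n) a.1 i
      else b (P.vertex (n := n) a.1 i) := by
  unfold deformation
  exact vertex_homOfEdges _ _ _ _ _ _ a i

theorem edge_deformation {n : ℕ} (a : (P.coskeletonSSet ⊗ Δ[1]).obj (op (SimplexCategory.mk n)))
    {i j : Fin (n + 1)} (h : i ≤ j) :
    P.edge (n := n) ((deformation b e he e' he' he'').app (op (SimplexCategory.mk n)) a) i j =
      if cut a.2 j = (0 : Fin 2) then P.edge (n := n) a.1 i j
      else if cut a.2 i = (0 : Fin 2) then
        e (P.vertex (n := n) a.1 i) (P.vertex (n := n) a.1 j)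
      else e' (P.vertex (n := n) a.1 i) (P.vertex (n := n) a.1 j) := by
  unfold deformation
  exact edge_homOfEdges _ _ _ _ _ _ a h

theorem ι₀_deformation : SSet.ι₀ ≫ deformation b e he e' he' he'' = 𝟙 P.coskeletonSSet := by
  ext n σ
  refine coskeleton_ext (n := n.unop.len) (fun i => ?_) fun i j h => ?_
  · exact (vertex_deformation b e he e' he' he'' (n := n.unop.len) _ i).trans (if_pos rfl)
  · exact (edge_deformation b e he e' he' he'' (n := n.unop.len) _ h).trans (if_pos rfl)

theorem vertex_ι₁_deformation {n : ℕ} (σ : P.coskeletonSSet.obj (op (SimplexCategory.mk n)))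
    (i : Fin (n + 1)) :
    P.vertex (n := n) ((SSet.ι₁ ≫ deformation b e he e' he' he'').app
      (op (SimplexCategory.mk n)) σ) i = b (P.vertex (n := n) σ i) :=
  (vertex_deformation b e he e' he' he'' (SSet.ι₁.app _ σ) i).trans
    (if_neg (show ¬ (1 : Fin 2) = 0 by decide))

theorem edge_ι₁_deformation {n : ℕ} (σ : P.coskeletonSSet.obj (op (SimplexCategory.mk n)))
    {i j : Fin (n + 1)} (h : i ≤ j) :
    P.edge (n := n) ((SSet.ι₁ ≫ deformation b e he e' he' he'').app
      (op (SimplexCategory.mk n)) σ) i j = e' (P.vertex (n := n) σ i) (P.vertex (n := n) σ j) :=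
  (edge_deformation b e he e' he' he'' (SSet.ι₁.app _ σ) h).trans
    ((if_neg (show ¬ (1 : Fin 2) = 0 by decide)).trans
      (if_neg (show ¬ (1 : Fin 2) = 0 by decide)))

/-- If `π` is surjective, the simplicial set underlying `M_*(X, G, π)` contracts to the vertex
`1`. -/
def contraction (hπ : Function.Surjective P.π) :
    SSet.Homotopy (𝟙 P.coskeletonSSet) (SSet.const P.baseVertex) where
  -- An edge from `v` to `1` needs a component with image `v` under `π`; edges between moved
  -- vertices are trivial.
  h := deformation (fun _ => 1) (fun v _ => Function.surjInv hπ v)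
    (fun v _ => by rw [Function.surjInv_eq hπ, mul_one]) (fun _ _ => 1) (by simp) (by simp)
  h₀ := ι₀_deformation _ _ _ _ _ _
  h₁ := by
    ext n σ
    have h1 : ∀ f : op (SimplexCategory.mk 0) ⟶ n, ((coskeleton.obj P).map f).hom 1 =
      (1 : (coskeleton.obj P).obj n) := fun f => map_one ((coskeleton.obj P).map f).hom
    refine coskeleton_ext (n := n.unop.len) (fun i => ?_) fun i j h => ?_
    · refine (vertex_ι₁_deformation _ _ _ _ _ _ (n := n.unop.len) σ i).trans ?_
      exact (vertex_one i).symm.trans (congrArg (fun τ => P.vertex τ i) (h1 _).symm)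
    · refine (edge_ι₁_deformation _ _ _ _ _ _ (n := n.unop.len) σ h).trans ?_
      exact (edge_one i j).symm.trans (congrArg (fun τ => P.edge τ i j) (h1 _).symm)
  rel := by
    -- The homotopy is relative to the empty subcomplex, so there is nothing to check.
    ext n ⟨⟨_, h⟩, _⟩
    exact h.elim

/-! ### An equivariant deformation and its descent to the quotient. -/

variable (t : P.G → P.X) (ht : ∀ g, P.π (t g) = g) (ht₁ : t 1 = 1)

/-- The deformation of `M_*(X, G, π)` onto the simplices whose edges depend only on the vertices,
for a section `t` of `π`. -/
def sectionDeformation : P.coskeletonSSet ⊗ Δ[1] ⟶ P.coskeletonSSet :=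
  deformation (fun v => v) (fun v w => t (v * w⁻¹)) (by simp [ht])
    (fun v w => t (v * w⁻¹)) (by simp [ht]) (by simp [ht₁])

/-- The value of `sectionDeformation` at an `n`-simplex of `M_*(X, G, π)` and one of `Δ[1]`. -/
def sectionDeform {n : SimplexCategoryᵒᵖ} (σ : (coskeleton.obj P).obj n)
    (ε : (Δ[1] : SSet.{u}).obj n) : (coskeleton.obj P).obj n :=
  (sectionDeformation t ht ht₁).app n (show (P.coskeletonSSet ⊗ Δ[1]).obj n from (σ, ε))

theorem map_sectionDeform {m n : SimplexCategoryᵒᵖ} (f : m ⟶ n)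
    (σ : (coskeleton.obj P).obj m) (ε : (Δ[1] : SSet.{u}).obj m) :
    sectionDeform t ht ht₁ (((coskeleton.obj P).map f).hom σ) ((Δ[1] : SSet.{u}).map f ε) =
      ((coskeleton.obj P).map f).hom (sectionDeform t ht ht₁ σ ε) := by
  let a : (P.coskeletonSSet ⊗ Δ[1]).obj m := (σ, ε)
  exact ConcreteCategory.congr_hom ((sectionDeformation t ht ht₁).naturality f) a

theorem vertex_sectionDeform {n : ℕ} (σ : (coskeleton.obj P).obj (op (SimplexCategory.mk n)))
    (ε : (Δ[1] : SSet.{u}).obj (op (SimplexCategory.mk n))) (i : Fin (n + 1)) :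
    P.vertex (sectionDeform t ht ht₁ σ ε) i = P.vertex σ i :=
  (vertex_deformation _ _ _ _ _ _ _ _).trans (ite_self _)

theorem edge_sectionDeform {n : ℕ} (σ : (coskeleton.obj P).obj (op (SimplexCategory.mk n)))
    (ε : (Δ[1] : SSet.{u}).obj (op (SimplexCategory.mk n))) {i j : Fin (n + 1)} (h : i ≤ j) :
    P.edge (sectionDeform t ht ht₁ σ ε) i j =
      if cut ε j = (0 : Fin 2) then P.edge σ i j else t (P.vertex σ i * (P.vertex σ j)⁻¹) :=
  (edge_deformation _ _ _ _ _ _ _ h).trans (by rw [ite_self])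

/-- The deformation of `M_*(X, G, π) / G` onto the simplices whose edges depend only on the
vertices, for a section `t` of `π`. -/
def quotientDeformation : coskeletonQuotient.obj P ⊗ Δ[1] ⟶ coskeletonQuotient.obj P where
  app n := TypeCat.ofHom fun a => Quotient.map'
    (fun σ : (coskeleton.obj P).obj n => sectionDeform t ht ht₁ σ a.2)
    (fun σ τ h => by
      obtain ⟨g, hv, he⟩ := (leftRel_iff (n := n.unop.len) σ τ).1 h
      refine (leftRel_iff (n := n.unop.len) _ _).2 ⟨g, fun i => ?_, fun i j hij => ?_⟩
      · exact (vertex_sectionDeform t ht ht₁ _ _ i).trans ((hv i).trans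
          (congrArg (· * g) (vertex_sectionDeform t ht ht₁ _ _ i).symm))
      · refine (edge_sectionDeform t ht ht₁ _ _ hij).trans
          (Eq.trans ?_ (edge_sectionDeform t ht ht₁ _ _ hij).symm)
        -- The new edge is orbit-invariant, since `(v * g) * (w * g)⁻¹ = v * w⁻¹`.
        rw [he i j hij, hv, hv]
        simp) a.1
  naturality m n f := by
    ext ⟨q, ε⟩
    induction q using QuotientGroup.induction_on with
    | H σ => exact congrArg QuotientGroup.mk (map_sectionDeform t ht ht₁ f σ ε)

theorem ι₀_quotientDeformation :
    SSet.ι₀ ≫ quotientDeformation t ht ht₁ = 𝟙 (coskeletonQuotient.obj P) := by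
  ext n q
  induction q using QuotientGroup.induction_on with
  | H σ => exact congrArg QuotientGroup.mk (ConcreteCategory.congr_hom
      (congr_app (ι₀_deformation (P := P) (fun v => v) (fun v w => t (v * w⁻¹)) (by simp [ht])
        (fun v w => t (v * w⁻¹)) (by simp [ht]) (by simp [ht₁])) n) σ)

/-- The endomorphism of `M_*(X, G, π) / G` which replaces the edges by those given by a section
`t` of `π`. -/
def rectify : coskeletonQuotient.obj P ⟶ coskeletonQuotient.obj P :=
  SSet.ι₁ ≫ quotientDeformation t ht ht₁

/-- The homotopy from the identity to `rectify`. -/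
def rectifyHomotopy : SSet.Homotopy (𝟙 (coskeletonQuotient.obj P)) (rectify t ht ht₁) where
  h := quotientDeformation t ht ht₁
  h₀ := ι₀_quotientDeformation t ht ht₁
  h₁ := rfl
  rel := by
    ext n ⟨⟨_, h⟩, _⟩
    exact h.elim

theorem exists_rectify_mk_eq {n : ℕ}
    (σ : (coskeleton.obj P).obj (op (SimplexCategory.mk n))) :
    ∃ τ : (coskeleton.obj P).obj (op (SimplexCategory.mk n)),
      (rectify t ht ht₁).app (op (SimplexCategory.mk n)) (QuotientGroup.mk σ) =
        QuotientGroup.mk τ ∧ (∀ i, P.vertex τ i = P.vertex σ i) ∧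
      ∀ i j, i ≤ j → P.edge τ i j = t (P.vertex σ i * (P.vertex σ j)⁻¹) := by
  refine ⟨_, rfl, fun i => vertex_sectionDeform t ht ht₁ σ _ i, fun i j h => ?_⟩
  exact (edge_sectionDeform t ht ht₁ σ _ h).trans (if_neg (by exact one_ne_zero))

end PreCrossedModule

namespace PreCrossedModule

/-! ### Bar coordinates on the quotient. -/

open MonoidalCategory Simplicial

variable {P : PreCrossedModule.{u}}

/-- The inhomogeneous coordinates `v₀v₁⁻¹, …, vₙ₋₁vₙ⁻¹` of an `n`-simplex of `M_*(X, G, π) / G`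
with vertices `v₀, …, vₙ`. -/
def barCoord {n : ℕ} (q : (coskeletonQuotient.obj P).obj (op (SimplexCategory.mk n))) :
    Fin n → P.G :=
  Quotient.liftOn' q (fun σ i => P.vertex σ i.castSucc * (P.vertex σ i.succ)⁻¹) fun σ τ h => by
    obtain ⟨g, hv, -⟩ := (leftRel_iff σ τ).1 h
    funext i
    rw [hv, hv]
    group

theorem barCoord_mk {n : ℕ} (σ : (coskeleton.obj P).obj (op (SimplexCategory.mk n))) (i : Fin n) :
    barCoord (P := P) (QuotientGroup.mk σ) i =
      P.vertex σ i.castSucc * (P.vertex σ i.succ)⁻¹ := rfl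

/-- Equal consecutive quotients force the vertices to differ by one common right translation, which
can be read off at the vertex `0`. -/
theorem vertex_mul_inv_eq_of_barCoord_eq {n : ℕ}
    {σ τ : (coskeleton.obj P).obj (op (SimplexCategory.mk n))}
    (h : barCoord (P := P) (QuotientGroup.mk σ) = barCoord (P := P) (QuotientGroup.mk τ))
    (i : Fin (n + 1)) :
    (P.vertex σ 0)⁻¹ * P.vertex τ 0 = (P.vertex σ i)⁻¹ * P.vertex τ i := by
  induction i using Fin.induction with
  | zero => rfl
  | succ i ih =>
    have h1 := congrFun h i
    rw [barCoord_mk, barCoord_mk, mul_inv_eq_iff_eq_mul] at h1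
    rw [ih, h1]
    group

theorem barCoord_surjective (hπ : Function.Surjective P.π) (n : ℕ) :
    Function.Surjective (barCoord (P := P) (n := n)) := by
  intro f
  classical
  -- With `v i = (f 0 ⋯ f (i-1))⁻¹` the product `v i * (v (i+1))⁻¹` telescopes to `f i`.
  let v : Fin (n + 1) → P.G := fun i => (Fin.partialProd f i)⁻¹
  refine ⟨QuotientGroup.mk (ofEdges v
    (fun i j => if i = j then 1 else Function.surjInv hπ (v i * (v j)⁻¹)) (by simp) ?_), ?_⟩
  · intro i j h
    split_ifs with h1
    · rw [h1, map_one, one_mul]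
    · rw [Function.surjInv_eq hπ, inv_mul_cancel_right]
  · funext i
    rw [barCoord_mk, vertex_ofEdges, vertex_ofEdges, inv_inv]
    exact Fin.partialProd_right_inv f i

section rectify

variable (t : P.G → P.X) (ht : ∀ g, P.π (t g) = g) (ht₁ : t 1 = 1)

theorem barCoord_rectify {n : ℕ}
    (q : (coskeletonQuotient.obj P).obj (op (SimplexCategory.mk n))) :
    barCoord ((rectify t ht ht₁).app _ q) = barCoord q := by
  induction q using QuotientGroup.induction_on with
  | H σ =>
    obtain ⟨τ, h, hv, -⟩ := exists_rectify_mk_eq t ht ht₁ σ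
    refine (congrArg barCoord h).trans ?_
    funext i
    rw [barCoord_mk, barCoord_mk, hv, hv]

/-- After rectification the edges are functions of the vertices, invariant under right translation,
and the bar coordinates determine the vertices up to such a translation. -/
theorem rectify_eq_of_barCoord_eq {n : ℕ}
    {q r : (coskeletonQuotient.obj P).obj (op (SimplexCategory.mk n))}
    (h : barCoord q = barCoord r) :
    (rectify t ht ht₁).app _ q = (rectify t ht ht₁).app _ r := by
  induction q using QuotientGroup.induction_on with
  | H σ =>
  induction r using QuotientGroup.induction_on with
  | H τ =>
    obtain ⟨σ', h₁, hv₁, he₁⟩ := exists_rectify_mk_eq t ht ht₁ σ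
    obtain ⟨τ', h₂, hv₂, he₂⟩ := exists_rectify_mk_eq t ht ht₁ τ
    refine h₁.trans (Eq.trans ?_ h₂.symm)
    have hg : ∀ i, P.vertex τ i = P.vertex σ i * ((P.vertex σ 0)⁻¹ * P.vertex τ 0) := fun i => by
      rw [vertex_mul_inv_eq_of_barCoord_eq h i, mul_inv_cancel_left]
    refine Quotient.sound' ((leftRel_iff σ' τ').2
      ⟨(P.vertex σ 0)⁻¹ * P.vertex τ 0, fun i => ?_, fun i j hij => ?_⟩)
    · rw [hv₁, hv₂, ← hg]
    · rw [he₁ i j hij, he₂ i j hij, hg i, hg j]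
      group

end rectify

theorem vertex_δ {n : ℕ} (σ : (coskeleton.obj P).obj (op (SimplexCategory.mk (n + 1))))
    (j : Fin (n + 2)) (i : Fin (n + 1)) :
    P.vertex (((coskeleton.obj P).map (SimplexCategory.δ j).op).hom σ) i =
      P.vertex σ (j.succAbove i) :=
  vertex_map _ _ _

theorem barCoord_δ_zero {n : ℕ}
    (q : (coskeletonQuotient.obj P).obj (op (SimplexCategory.mk (n + 1)))) :
    barCoord ((coskeletonQuotient.obj P).δ 0 q) = fun i => barCoord q i.succ := by
  induction q using QuotientGroup.induction_on with
  | H σ =>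
    funext i
    refine (congrArg₂ (fun a b => a * b⁻¹) (vertex_δ σ 0 i.castSucc) (vertex_δ σ 0 i.succ)).trans ?_
    rw [Fin.zero_succAbove, Fin.zero_succAbove]
    rfl

/-- Omitting an inner vertex merges its two adjacent quotients into their product. Omitting the last
one, `j = n`, just drops the last coordinate, which is also what `Fin.contractNth` does there. -/
theorem barCoord_δ_succ {n : ℕ}
    (q : (coskeletonQuotient.obj P).obj (op (SimplexCategory.mk (n + 1)))) (j : Fin (n + 1)) :
    barCoord ((coskeletonQuotient.obj P).δ j.succ q) = Fin.contractNth j (· * ·) (barCoord q) := by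
  induction q using QuotientGroup.induction_on with
  | H σ =>
    funext i
    refine (congrArg₂ (fun a b => a * b⁻¹) (vertex_δ σ j.succ i.castSucc)
      (vertex_δ σ j.succ i.succ)).trans ?_
    rcases lt_trichotomy (i : ℕ) j with h | h | h
    · rw [Fin.contractNth_apply_of_lt _ _ _ _ h, barCoord_mk,
        Fin.succAbove_of_castSucc_lt _ _ (by simp [Fin.lt_def]; omega),
        Fin.succAbove_of_castSucc_lt _ _ (by simp [Fin.lt_def]; omega)]
      rfl
    · rw [Fin.contractNth_apply_of_eq _ _ _ _ h, barCoord_mk, barCoord_mk,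
        Fin.succAbove_of_castSucc_lt _ _ (by simp [Fin.lt_def]; omega),
        Fin.succAbove_of_le_castSucc _ _ (by simp [Fin.le_def]; omega)]
      rw [Fin.succ_castSucc]
      group
    · rw [Fin.contractNth_apply_of_gt _ _ _ _ h, barCoord_mk,
        Fin.succAbove_of_le_castSucc _ _ (by simp [Fin.le_def]; omega),
        Fin.succAbove_of_le_castSucc _ _ (by simp [Fin.le_def]; omega)]
      rfl

/-! ### The classifying chain map and its naturality. -/

variable (k : Type u) [CommRing k]

open groupHomology

variable (P) in
/-- The component in degree `n` of the chain map which classifies the free action of `G` on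
`M_*(X, G, π)`. -/
def classifyingX (n : ℕ) : ((coskeletonQuotient.obj P).chainComplex (ModuleCat.of k k)).X n ⟶
    (inhomogeneousChains (Rep.trivial k P.G k)).X n :=
  (SSet.isColimitChainComplexXCofan (coskeletonQuotient.obj P) (ModuleCat.of k k) n).desc
    (Cofan.mk _ fun q => ModuleCat.ofHom (Finsupp.lsingle (M := k) (R := k) (barCoord q)))

theorem ι_classifyingX {n : ℕ}
    (q : (coskeletonQuotient.obj P).obj (op (SimplexCategory.mk n))) :
    (coskeletonQuotient.obj P).ιChainComplex q ≫ classifyingX P k n =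
      ModuleCat.ofHom (Finsupp.lsingle (M := k) (R := k) (barCoord q)) :=
  (SSet.isColimitChainComplexXCofan (coskeletonQuotient.obj P) (ModuleCat.of k k) n).fac _ ⟨q⟩

variable (P) in
/-- The chain map which classifies the free action of `G` on `M_*(X, G, π)`. -/
def classifyingMap : (coskeletonQuotient.obj P).chainComplex (ModuleCat.of k k) ⟶
    inhomogeneousChains (Rep.trivial k P.G k) where
  f := classifyingX P k
  comm' i j hij := by
    obtain rfl : j + 1 = i := hij
    refine SSet.chainComplex_hom_ext fun q => ?_
    rw [inhomogeneousChains.d_def, ← Category.assoc, ι_classifyingX, ← Category.assoc,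
      SSet.ιChainComplex_d, Preadditive.sum_comp]
    simp_rw [Preadditive.zsmul_comp, ι_classifyingX]
    refine ModuleCat.hom_ext (LinearMap.ext fun a => ?_)
    refine (inhomogeneousChains.d_single (A := Rep.trivial k P.G k) j (barCoord q) a).trans ?_
    -- The face `0` gives the term of the bar differential in which the first entry would act on the
    -- coefficients, here trivially; the other faces give the contractions.
    rw [ModuleCat.hom_sum, LinearMap.sum_apply, Fin.sum_univ_succ (n := j + 1)]
    refine congrArg₂ (· + ·) ?_ (Finset.sum_congr rfl fun i _ => ?_)
    · rw [barCoord_δ_zero]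
      simp
    · rw [barCoord_δ_succ]
      simp

theorem ι_classifyingMap_f {n : ℕ}
    (q : (coskeletonQuotient.obj P).obj (op (SimplexCategory.mk n))) :
    (coskeletonQuotient.obj P).ιChainComplex q ≫ (classifyingMap P k).f n =
      ModuleCat.ofHom (Finsupp.lsingle (M := k) (R := k) (barCoord q)) :=
  ι_classifyingX k q

theorem classifyingMap_naturality {P Q : PreCrossedModule.{u}} (φ : P ⟶ Q) :
    SSet.chainComplexMap (coskeletonQuotient.map φ) (ModuleCat.of k k) ≫ classifyingMap Q k =
      classifyingMap P k ≫ chainsMap φ.onG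
        (show Rep.trivial k P.G k ⟶ Rep.res φ.onG (Rep.trivial k Q.G k) from
          𝟙 (Rep.trivial k P.G k)) := by
  refine HomologicalComplex.hom_ext _ _ fun n => SSet.chainComplex_hom_ext fun q => ?_
  rw [HomologicalComplex.comp_f, HomologicalComplex.comp_f, SSet.ι_chainComplexMap_f_assoc,
    ι_classifyingMap_f, ← Category.assoc, ι_classifyingMap_f]
  refine Eq.trans ?_ (lsingle_comp_chainsMap_f (A := Rep.trivial k P.G k)
    (B := Rep.trivial k Q.G k) φ.onG _ n (barCoord q)).symm
  have h : barCoord ((coskeletonQuotient.map φ).app _ q) = φ.onG ∘ barCoord q := by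
    induction q using QuotientGroup.induction_on with
    | H σ =>
      funext i
      refine (congrArg₂ (fun a b => a * b⁻¹) (vertex_app φ σ i.castSucc)
        (vertex_app φ σ i.succ)).trans ?_
      rw [Function.comp_apply, barCoord_mk, map_mul, map_inv]
  rw [h]
  rfl

/-- The transformation induced by the chain map which classifies the free action of `G` on
`M_*(X, G, π)`. -/
def classifyingTransformation (m : ℕ) :
    coskeletonHomology.{u} k m ⟶ toGroup ⋙ groupHomologyFunctor k m where
  app P := HomologicalComplex.homologyMap (classifyingMap P k) m
  naturality _ _ φ := (HomologicalComplex.homologyMap_comp _ _ _).symm.trans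
    ((congrArg (fun f => HomologicalComplex.homologyMap f m)
      (classifyingMap_naturality k φ)).trans (HomologicalComplex.homologyMap_comp _ _ _))

/-! ### The isomorphism for surjective `π`. -/

theorem isIso_homologyMap_classifyingMap (hπ : Function.Surjective P.π) (m : ℕ) :
    IsIso (HomologicalComplex.homologyMap (classifyingMap P k) m) := by
  classical
  -- The section is corrected at `1`, because degenerate edges must have trivial component.
  let t : P.G → P.X := fun g => if g = 1 then 1 else Function.surjInv hπ g
  have ht : ∀ g, P.π (t g) = g := fun g => by
    dsimp only [t]
    split_ifs with h
    · rw [map_one, h]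
    · exact Function.surjInv_eq hπ g
  have ht₁ : t 1 = 1 := if_pos rfl
  let C := (coskeletonQuotient.obj P).chainComplex (ModuleCat.of k k)
  let r : C ⟶ C := SSet.chainComplexMap (rectify t ht ht₁) (ModuleCat.of k k)
  let c := classifyingMap P k
  let ι (n : ℕ) (q : (coskeletonQuotient.obj P).obj (op (SimplexCategory.mk n))) :
      ModuleCat.of k k ⟶ C.X n := (coskeletonQuotient.obj P).ιChainComplex q
  -- Lift a bar generator to any simplex and rectify; the result does not depend on the lift.
  let s (n : ℕ) : (inhomogeneousChains (Rep.trivial k P.G k)).X n ⟶ C.X n :=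
    ModuleCat.ofHom (Finsupp.lsum (M := k) k fun f => (ι n ((rectify t ht ht₁).app _
      (Function.surjInv (barCoord_surjective hπ n) f))).hom)
  have hs (n : ℕ) (f : Fin n → P.G) :
      ModuleCat.ofHom (Finsupp.lsingle (M := k) (R := k) f) ≫ s n =
        ι n ((rectify t ht ht₁).app _ (Function.surjInv (barCoord_surjective hπ n) f)) :=
    ModuleCat.hom_ext (LinearMap.ext fun a => by
      exact (Finsupp.lsum_single (M := k) k _ _ _))
  have hsc (n : ℕ) : s n ≫ c.f n = 𝟙 _ := by
    refine inhomogeneousChains.ext fun f => ?_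
    refine (Category.assoc _ _ _).symm.trans ((congrArg (· ≫ c.f n) (hs n f)).trans
      ((ι_classifyingMap_f k _).trans ?_))
    rw [barCoord_rectify, Function.surjInv_eq (barCoord_surjective hπ n)]
    exact (Category.comp_id _).symm
  have hcs (n : ℕ) : c.f n ≫ s n = r.f n := by
    refine SSet.chainComplex_hom_ext fun q => ?_
    refine (Category.assoc _ _ _).symm.trans ((congrArg (· ≫ s n) (ι_classifyingMap_f k q)).trans
      ((hs n _).trans ?_))
    rw [SSet.ι_chainComplexMap_f]
    exact congrArg (ι n) (rectify_eq_of_barCoord_eq t ht ht₁ (Function.surjInv_eq _ _))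
  let s' : inhomogeneousChains (Rep.trivial k P.G k) ⟶ C :=
    { f := s
      comm' := fun i j _ => by
        -- That `s` commutes with differentials can be tested after the epimorphism `c.f i`, where
        -- `c.f i ≫ s i` is the component of the chain map `r`.
        have : IsSplitEpi (c.f i) := ⟨⟨⟨s i, hsc i⟩⟩⟩
        rw [← cancel_epi (c.f i), ← Category.assoc, hcs, r.comm, ← hcs, ← Category.assoc, ← c.comm,
          Category.assoc] }
  have h₁ : s' ≫ c = 𝟙 _ := HomologicalComplex.hom_ext _ _ hsc
  have h₂ : c ≫ s' = r := HomologicalComplex.hom_ext _ _ hcs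
  refine ⟨HomologicalComplex.homologyMap s' m, ?_, ?_⟩
  · rw [← HomologicalComplex.homologyMap_comp, h₂]
    exact ((rectifyHomotopy t ht ht₁).congr_homologyMap (ModuleCat.of k k) m).symm.trans
      (SSet.homologyMap_id _ _ _)
  · rw [← HomologicalComplex.homologyMap_comp, h₁, HomologicalComplex.homologyMap_id]

end PreCrossedModule

end

theorem mainTheorem3 (k : Type u) [CommRing k] :
    ∃ (θ : ∀ m : ℕ, PreCrossedModule.PH.{u} k m ⟶
          PreCrossedModule.toGroup ⋙ groupHomologyFunctor k m)
      (κ : ∀ m : ℕ, PreCrossedModule.coskeletonHomology.{u} k m ⟶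
          PreCrossedModule.toGroup ⋙ groupHomologyFunctor k m),
      (∀ m : ℕ, θ m = PreCrossedModule.canonicalHomologyMap k m ≫ κ m) ∧
      (∀ P : PreCrossedModule.{u},
        ∃ c : (PreCrossedModule.coskeletonQuotient.obj P).chainComplex (ModuleCat.of k k) ⟶
            groupHomology.inhomogeneousChains (Rep.trivial k P.G k),
          (∀ (n : ℕ) (σ : (PreCrossedModule.coskeleton.obj P).obj (op (SimplexCategory.mk n))),
            SSet.ιChainComplex (X := PreCrossedModule.coskeletonQuotient.obj P)
                (QuotientGroup.mk σ) ≫ c.f n =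
              ModuleCat.ofHom (Finsupp.lsingle (fun i : Fin n =>
                P.vertex σ i.castSucc * (P.vertex σ i.succ)⁻¹))) ∧
          ∀ m : ℕ, (κ m).app P = HomologicalComplex.homologyMap c m) ∧
      ∀ P : PreCrossedModule.{u}, Function.Surjective P.π →
        Nonempty (SSet.Homotopy (𝟙 P.coskeletonSSet) (SSet.const P.baseVertex)) ∧
        ∀ m : ℕ, IsIso ((κ m).app P) :=
  ⟨fun m => PreCrossedModule.canonicalHomologyMap k m ≫
      PreCrossedModule.classifyingTransformation k m,
    PreCrossedModule.classifyingTransformation k, fun _ => rfl,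
    fun P => ⟨PreCrossedModule.classifyingMap P k,
      fun _ _ => PreCrossedModule.ι_classifyingMap_f k _, fun _ => rfl⟩,
    fun _ hπ => ⟨⟨PreCrossedModule.contraction hπ⟩,
      PreCrossedModule.isIso_homologyMap_classifyingMap k hπ⟩⟩
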